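/- \textbf{Theorem} (The equivalent algebraic semantics of $\mathsf{MALL}$ is the variety of bounded Girard algebras). Formulas are built from countably many variables with the connectives $\to,\cdot,\wedge,\vee$ (binary), $\neg$ (unary) and the constants $0,1,\top,\bot$. Let $\Gamma\vdash_{\mathsf{MALL}}\varphi$ mean that $\varphi$ is derivable from $\Gamma$ by the rules (MP) $p,\ p\to q\ /\ q$ and (Adj) $p,\ q\ /\ p\wedge q$ from all instances of the axioms (HL1) $p\to p$; (HL2) $(p\to q)\to((q\to r)\to(p\to r))$; (HL3) $(p\to(q\to r))\to(q\to(p\to r))$; (HL4) $\neg\neg p\to p$; (HL5) $(p\to\neg q)\to(q\to\neg p)$; (HL6) $p\to(q\to p\cdot q)$; (HL7) $(p\to(q\to r))\to(p\cdot q\to r)$; (HL8) $1$; (HL9) $1\to(p\to p)$; (HL10) $p\to(\neg p\to 0)$; (HL11) $\neg 0$; (HL12) $p\wedge q\to p$; (HL13) $p\wedge q\to q$; (HL14) $(p\to q)\wedge(p\to r)\to(p\to q\wedge r)$; (HL15) $p\to p\vee q$; (HL16) $q\to p\vee q$; (HL17) $(p\to r)\wedge(q\to r)\to(p\vee q\to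 r)$; (HL18) $p\to\top$; (HL19) $\bot\to p$. A \emph{bounded Girard algebra} is an algebra $\langle A,\vee,\wedge,\to,\cdot,0,1,\top\rangle$ such that $\langle A,\vee,\wedge\rangle$ is a lattice, $\langle A,\cdot,1\rangle$ is a commutative monoid, $a\cdot b\le c\iff b\le a\to c$, $(b\to 0)\to 0=b$ and $1\le b\to\top$ for all $a,b,c\in A$. It is regarded as an algebra in the language of $\mathsf{MALL}$ by putting $\neg x:=x\to 0$ and $\bot:=\neg\top$. For a class $K$ of algebras, $\Theta\models_K e$ means that in each algebra of $K$ every assignment satisfying all equations in $\Theta$ satisfies the equation $e$; for a set $E$ of equations, $\Theta\models_K E$ means $\Theta\models_K e$ for all $e\in E$. The class $K$ is an \emph{equivalent algebraic semantics} of a deductive system $\vdash$, with a finite set $\tau(p)$ of defining equations in one variable and a finite set $\Delta(p,q)$ of congruence formulas in two variables, if for all sets $\Gamma$ of formulas and all formulas $\varphi,\psi$, $$\Gamma\vdash\varphi\iff\bigcup_{\gamma\in\Gamma}\tau(\gamma)\models_K\tau(\varphi),\qquad \varphi\approx\psi\ \text{ and }\bigcup_{\chi\in\Delta(\varphi,\psi)}\tau(\chi)\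 \text{ imply each other under }\models_K .$$ The system is \emph{algebraizable} if such $K,\tau,\Delta$ exist. Then $\mathsf{MALL}$ is algebraizable. The class $\mathcal{BG}$ of bounded Girard algebras, in the language of $\mathsf{MALL}$, is a variety, and it is an equivalent algebraic semantics of $\mathsf{MALL}$ with defining equation $p\wedge 1\approx 1$ and congruence formulas $\{p\to q,\ q\to p\}$. It is the only quasivariety with this property: every quasivariety that is an equivalent algebraic semantics of $\mathsf{MALL}$, with respect to any finite $\tau$ and $\Delta$, equals $\mathcal{BG}$. -/

import Mathlib

universe u

/-! ## Deductive systems, varieties and algebraizability (Blok and Pigozzi)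

Formulas over a propositional language are the terms of a first-order language `L` without relation
symbols, over the countable set `ℕ` of variables; algebras of that type are the `L`-structures. -/

namespace AAL

open FirstOrder.Language

variable {L : FirstOrder.Language.{0, 0}}

/-- A 1-deductive system over `L`: a consequence relation between sets of formulas and formulas
that is reflexive, transitive (cut), finitary and structural (closed under substitutions).
Monotonicity is the special case of `cut` in which every formula of `Γ` is in `Γ'`. -/
structure DeductiveSystem (L : FirstOrder.Language.{0, 0}) where
  Proves : Set (L.Term ℕ) → L.Term ℕ → Prop
  refl : ∀ {Γ : Set (L.Term ℕ)} {φ : L.Term ℕ}, φ ∈ Γ → Proves Γ φ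
  cut : ∀ {Γ Γ' : Set (L.Term ℕ)} {φ : L.Term ℕ},
    Proves Γ φ → (∀ γ ∈ Γ, Proves Γ' γ) → Proves Γ' φ
  finitary : ∀ {Γ : Set (L.Term ℕ)} {φ : L.Term ℕ},
    Proves Γ φ → ∃ Γ₀ : Set (L.Term ℕ), Γ₀ ⊆ Γ ∧ Γ₀.Finite ∧ Proves Γ₀ φ
  structural : ∀ {Γ : Set (L.Term ℕ)} {φ : L.Term ℕ} (σ : ℕ → L.Term ℕ),
    Proves Γ φ → Proves ((fun γ => γ.subst σ) '' Γ) (φ.subst σ)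

/-- An equation `s ≈ t` between terms with variables in `α`. -/
structure Equation (L : FirstOrder.Language.{0, 0}) (α : Type) where
  lhs : L.Term α
  rhs : L.Term α

/-- The equation `e` is true in the algebra `A` under the assignment `v`. -/
def Equation.Holds {α : Type} (e : Equation L α) {A : Type u} [L.Structure A] (v : α → A) : Prop :=
  e.lhs.realize v = e.rhs.realize v

/-- Simultaneous substitution in both sides of an equation. -/
def Equation.subst {α β : Type} (e : Equation L α) (σ : α → L.Term β) : Equation L β :=
  ⟨e.lhs.subst σ, e.rhs.subst σ⟩

/-- A quasi-equation: finitely many equations imply an equation. -/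
structure QuasiEquation (L : FirstOrder.Language.{0, 0}) where
  premises : List (Equation L ℕ)
  conclusion : Equation L ℕ

/-- A class of algebras of type `L`. -/
abbrev AlgebraClass (L : FirstOrder.Language.{0, 0}) : Type (u + 1) :=
  ∀ (A : Type u) [L.Structure A], Prop

/-- A variety: a class of algebras axiomatized by a set of equations. -/
def IsVariety (K : AlgebraClass.{u} L) : Prop :=
  ∃ E : Set (Equation L ℕ), ∀ (A : Type u) [L.Structure A],
    K A ↔ ∀ e ∈ E, ∀ v : ℕ → A, e.Holds v

/-- A quasivariety: a class of algebras axiomatized by a set of quasi-equations. -/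
def IsQuasivariety (K : AlgebraClass.{u} L) : Prop :=
  ∃ Q : Set (QuasiEquation L), ∀ (A : Type u) [L.Structure A],
    K A ↔ ∀ q ∈ Q, ∀ v : ℕ → A, (∀ e ∈ q.premises, e.Holds v) → q.conclusion.Holds v

/-- The equational consequence relation `Θ ⊨_K e` of a class `K` of algebras. -/
def EqConsequence (K : AlgebraClass.{u} L) (Θ : Set (Equation L ℕ)) (e : Equation L ℕ) : Prop :=
  ∀ (A : Type u) [L.Structure A], K A → ∀ v : ℕ → A, (∀ d ∈ Θ, d.Holds v) → e.Holds v

/-- The set `τ(φ)` of equations `δ(φ) ≈ ε(φ)`, for `δ ≈ ε` in the set `τ` of equations in one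
variable. -/
def translate (τ : Set (Equation L (Fin 1))) (φ : L.Term ℕ) : Set (Equation L ℕ) :=
  (fun e => e.subst ![φ]) '' τ

/-- The set `Δ(φ, ψ)` of formulas, for a set `Δ` of formulas in two variables. -/
def equivFormulas (Δ : Set (L.Term (Fin 2))) (φ ψ : L.Term ℕ) : Set (L.Term ℕ) :=
  (fun d => d.subst ![φ, ψ]) '' Δ

/-- The class `K` is an equivalent algebraic semantics of `S`, with (finite) set `τ` of defining
equations and (finite) set `Δ` of equivalence (congruence) formulas:
`Γ ⊢ φ` iff `τ(Γ) ⊨_K τ(φ)`, and `φ ≈ ψ` is equivalent over `K` to `τ(Δ(φ, ψ))`. -/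
structure IsEquivalentAlgebraicSemantics (S : DeductiveSystem L) (K : AlgebraClass.{u} L)
    (τ : Set (Equation L (Fin 1))) (Δ : Set (L.Term (Fin 2))) : Prop where
  finite_defining : τ.Finite
  finite_equiv : Δ.Finite
  proves_iff : ∀ (Γ : Set (L.Term ℕ)) (φ : L.Term ℕ),
    S.Proves Γ φ ↔ ∀ e ∈ translate τ φ, EqConsequence K (⋃ γ ∈ Γ, translate τ γ) e
  of_eq : ∀ (φ ψ : L.Term ℕ), ∀ e ∈ ⋃ χ ∈ equivFormulas Δ φ ψ, translate τ χ,
    EqConsequence K {⟨φ, ψ⟩} e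
  to_eq : ∀ (φ ψ : L.Term ℕ),
    EqConsequence K (⋃ χ ∈ equivFormulas Δ φ ψ, translate τ χ) ⟨φ, ψ⟩

/-- A deductive system is algebraizable if it has an equivalent algebraic semantics. -/
def Algebraizable (S : DeductiveSystem L) : Prop :=
  ∃ (K : AlgebraClass.{u} L) (τ : Set (Equation L (Fin 1))) (Δ : Set (L.Term (Fin 2))),
    IsEquivalentAlgebraicSemantics S K τ Δ

end AAL

/-! ## The logic MALL -/

namespace MALL

open FirstOrder.Language

/-- The connectives of MALL, by arity (par is the abbreviation `¬p → q`). -/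
inductive Connective : ℕ → Type
  | zero : Connective 0
  | one : Connective 0
  | top : Connective 0
  | bot : Connective 0
  | neg : Connective 1
  | mul : Connective 2
  | imp : Connective 2
  | meet : Connective 2
  | join : Connective 2

/-- The propositional language of MALL. -/
def lang : FirstOrder.Language.{0, 0} := ⟨Connective, fun _ => Empty⟩

/-- Formulas of MALL with propositional variables in `α`. -/
abbrev Formula (α : Type) : Type := lang.Term α

namespace Formula

variable {α β : Type}

/-- The formula consisting of the single propositional variable `a`. -/
def var (a : α) : Formula α := Term.var a

instance : Zero (Formula α) := ⟨.func (l := 0) Connective.zero ![]⟩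
instance : One (Formula α) := ⟨.func (l := 0) Connective.one ![]⟩
instance : Top (Formula α) := ⟨.func (l := 0) Connective.top ![]⟩
instance : Bot (Formula α) := ⟨.func (l := 0) Connective.bot ![]⟩
/-- Linear negation, written `pᶜ`. -/
instance : Compl (Formula α) := ⟨fun p => .func (l := 1) Connective.neg ![p]⟩
/-- Multiplicative conjunction. -/
instance : Mul (Formula α) := ⟨fun p q => .func (l := 2) Connective.mul ![p, q]⟩
/-- Linear implication. -/
instance : HImp (Formula α) := ⟨fun p q => .func (l := 2) Connective.imp ![p, q]⟩
/-- Additive conjunction. -/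
instance : Min (Formula α) := ⟨fun p q => .func (l := 2) Connective.meet ![p, q]⟩
/-- Additive disjunction. -/
instance : Max (Formula α) := ⟨fun p q => .func (l := 2) Connective.join ![p, q]⟩

variable (σ : α → Formula β) (p q : Formula α)

theorem subst_zero : Term.subst (0 : Formula α) σ = (0 : Formula β) :=
  congrArg (Term.func (l := 0) (L := lang) Connective.zero) (by funext i; exact i.elim0)

theorem subst_one : Term.subst (1 : Formula α) σ = (1 : Formula β) :=
  congrArg (Term.func (l := 0) (L := lang) Connective.one) (by funext i; exact i.elim0)

theorem subst_top : Term.subst (⊤ : Formula α) σ = (⊤ : Formula β) :=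
  congrArg (Term.func (l := 0) (L := lang) Connective.top) (by funext i; exact i.elim0)

theorem subst_bot : Term.subst (⊥ : Formula α) σ = (⊥ : Formula β) :=
  congrArg (Term.func (l := 0) (L := lang) Connective.bot) (by funext i; exact i.elim0)

theorem subst_neg : Term.subst (pᶜ) σ = (Term.subst p σ)ᶜ :=
  congrArg (Term.func (l := 1) (L := lang) Connective.neg) (by funext i; fin_cases i; rfl)

theorem subst_mul : Term.subst (p * q) σ = Term.subst p σ * Term.subst q σ :=
  congrArg (Term.func (l := 2) (L := lang) Connective.mul) (by funext i; fin_cases i <;> rfl)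

theorem subst_imp : Term.subst (p ⇨ q) σ = Term.subst p σ ⇨ Term.subst q σ :=
  congrArg (Term.func (l := 2) (L := lang) Connective.imp) (by funext i; fin_cases i <;> rfl)

theorem subst_meet : Term.subst (p ⊓ q) σ = Term.subst p σ ⊓ Term.subst q σ :=
  congrArg (Term.func (l := 2) (L := lang) Connective.meet) (by funext i; fin_cases i <;> rfl)

theorem subst_join : Term.subst (p ⊔ q) σ = Term.subst p σ ⊔ Term.subst q σ :=
  congrArg (Term.func (l := 2) (L := lang) Connective.join) (by funext i; fin_cases i <;> rfl)

end Formula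

/-- The axioms (HL1)-(HL19), as schemes. -/
inductive IsAxiom : Formula ℕ → Prop
  | hl1 (p : Formula ℕ) : IsAxiom (p ⇨ p)
  | hl2 (p q r : Formula ℕ) : IsAxiom ((p ⇨ q) ⇨ ((q ⇨ r) ⇨ (p ⇨ r)))
  | hl3 (p q r : Formula ℕ) : IsAxiom ((p ⇨ (q ⇨ r)) ⇨ (q ⇨ (p ⇨ r)))
  | hl4 (p : Formula ℕ) : IsAxiom (pᶜᶜ ⇨ p)
  | hl5 (p q : Formula ℕ) : IsAxiom ((p ⇨ qᶜ) ⇨ (q ⇨ pᶜ))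
  | hl6 (p q : Formula ℕ) : IsAxiom (p ⇨ (q ⇨ (p * q)))
  | hl7 (p q r : Formula ℕ) : IsAxiom ((p ⇨ (q ⇨ r)) ⇨ ((p * q) ⇨ r))
  | hl8 : IsAxiom 1
  | hl9 (p : Formula ℕ) : IsAxiom (1 ⇨ (p ⇨ p))
  | hl10 (p : Formula ℕ) : IsAxiom (p ⇨ (pᶜ ⇨ 0))
  | hl11 : IsAxiom (0ᶜ)
  | hl12 (p q : Formula ℕ) : IsAxiom ((p ⊓ q) ⇨ p)
  | hl13 (p q : Formula ℕ) : IsAxiom ((p ⊓ q) ⇨ q)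
  | hl14 (p q r : Formula ℕ) : IsAxiom (((p ⇨ q) ⊓ (p ⇨ r)) ⇨ (p ⇨ (q ⊓ r)))
  | hl15 (p q : Formula ℕ) : IsAxiom (p ⇨ (p ⊔ q))
  | hl16 (p q : Formula ℕ) : IsAxiom (q ⇨ (p ⊔ q))
  | hl17 (p q r : Formula ℕ) : IsAxiom (((p ⇨ r) ⊓ (q ⇨ r)) ⇨ ((p ⊔ q) ⇨ r))
  | hl18 (p : Formula ℕ) : IsAxiom (p ⇨ ⊤)
  | hl19 (p : Formula ℕ) : IsAxiom (⊥ ⇨ p)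

/-- Hilbert-style derivability from the hypotheses `Γ`, with the rules modus ponens and
adjunction. -/
inductive Derives (Γ : Set (Formula ℕ)) : Formula ℕ → Prop
  | hyp {p : Formula ℕ} : p ∈ Γ → Derives Γ p
  | ax {p : Formula ℕ} : IsAxiom p → Derives Γ p
  | mp {p q : Formula ℕ} : Derives Γ p → Derives Γ (p ⇨ q) → Derives Γ q
  | adj {p q : Formula ℕ} : Derives Γ p → Derives Γ q → Derives Γ (p ⊓ q)

theorem IsAxiom.subst {p : Formula ℕ} (h : IsAxiom p) (σ : ℕ → Formula ℕ) :
    IsAxiom (Term.subst p σ) := by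
  cases h <;>
    simp only [Formula.subst_zero, Formula.subst_one, Formula.subst_top, Formula.subst_bot,
      Formula.subst_neg, Formula.subst_mul, Formula.subst_imp, Formula.subst_meet,
      Formula.subst_join] <;>
    constructor

theorem Derives.cut {Γ Γ' : Set (Formula ℕ)} {p : Formula ℕ} (h : Derives Γ p)
    (hΓ : ∀ γ ∈ Γ, Derives Γ' γ) : Derives Γ' p := by
  induction h with
  | hyp h => exact hΓ _ h
  | ax h => exact .ax h
  | mp _ _ ih₁ ih₂ => exact .mp ih₁ ih₂
  | adj _ _ ih₁ ih₂ => exact .adj ih₁ ih₂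

theorem Derives.mono {Γ Γ' : Set (Formula ℕ)} {p : Formula ℕ} (h : Derives Γ p) (hΓ : Γ ⊆ Γ') :
    Derives Γ' p :=
  h.cut fun _ hγ => .hyp (hΓ hγ)

theorem Derives.finitary {Γ : Set (Formula ℕ)} {p : Formula ℕ} (h : Derives Γ p) :
    ∃ Γ₀ : Set (Formula ℕ), Γ₀ ⊆ Γ ∧ Γ₀.Finite ∧ Derives Γ₀ p := by
  induction h with
  | @hyp p h => exact ⟨{p}, by simpa using h, Set.finite_singleton p, .hyp rfl⟩
  | ax h => exact ⟨∅, Set.empty_subset _, Set.finite_empty, .ax h⟩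
  | mp _ _ ih₁ ih₂ =>
    obtain ⟨Γ₁, s₁, f₁, d₁⟩ := ih₁
    obtain ⟨Γ₂, s₂, f₂, d₂⟩ := ih₂
    exact ⟨Γ₁ ∪ Γ₂, Set.union_subset s₁ s₂, f₁.union f₂,
      .mp (d₁.mono Set.subset_union_left) (d₂.mono Set.subset_union_right)⟩
  | adj _ _ ih₁ ih₂ =>
    obtain ⟨Γ₁, s₁, f₁, d₁⟩ := ih₁
    obtain ⟨Γ₂, s₂, f₂, d₂⟩ := ih₂
    exact ⟨Γ₁ ∪ Γ₂, Set.union_subset s₁ s₂, f₁.union f₂,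
      .adj (d₁.mono Set.subset_union_left) (d₂.mono Set.subset_union_right)⟩

theorem Derives.structural {Γ : Set (Formula ℕ)} {p : Formula ℕ} (σ : ℕ → Formula ℕ)
    (h : Derives Γ p) : Derives ((fun γ => Term.subst γ σ) '' Γ) (Term.subst p σ) := by
  induction h with
  | hyp h => exact .hyp (Set.mem_image_of_mem _ h)
  | ax h => exact .ax (h.subst σ)
  | mp _ _ ih₁ ih₂ => exact .mp ih₁ (by rwa [Formula.subst_imp] at ih₂)
  | adj _ _ ih₁ ih₂ => rw [Formula.subst_meet]; exact .adj ih₁ ih₂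

/-- MALL as a deductive system. -/
def system : AAL.DeductiveSystem lang where
  Proves := Derives
  refl := .hyp
  cut := Derives.cut
  finitary := Derives.finitary
  structural := Derives.structural

/-- The defining equation `p ∧ 1 ≈ 1`. -/
def definingEquations : Set (AAL.Equation lang (Fin 1)) :=
  {⟨Formula.var 0 ⊓ 1, 1⟩}

/-- The congruence formulas `p → q` and `q → p`. -/
def congruenceFormulas : Set (Formula (Fin 2)) :=
  {Formula.var 0 ⇨ Formula.var 1, Formula.var 1 ⇨ Formula.var 0}

end MALL

/-! ## Bounded Girard algebras -/

/-- A commutative residuated lattice. The residual is written `a ⇨ b`. -/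
class CommResiduatedLattice (A : Type u) extends Lattice A, CommMonoid A, HImp A where
  residuation : ∀ a b c : A, a * b ≤ c ↔ b ≤ a ⇨ c

/-- A Girard algebra: a commutative residuated lattice with an involutive element `0`. -/
class GirardAlgebra (A : Type u) extends CommResiduatedLattice A, Zero A where
  involutive : ∀ b : A, (b ⇨ (0 : A)) ⇨ 0 = b

/-- A bounded Girard algebra: a Girard algebra with a constant `⊤` with `x → ⊤ ≥ 1` for all `x`. -/
class BoundedGirardAlgebra (A : Type u) extends GirardAlgebra A, Top A where
  one_le_himp_top : ∀ x : A, (1 : A) ≤ x ⇨ ⊤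

namespace BoundedGirardAlgebra

/-- A bounded Girard algebra as an algebra in the language of MALL: the basic operations interpret
the connectives of the same name, and `¬x := x → 0`, `⊥ := ¬⊤`. -/
@[reducible]
def mallStructure {A : Type u} (_ : BoundedGirardAlgebra A) : MALL.lang.Structure A where
  funMap := fun {n} (f : MALL.Connective n) =>
    match n, f with
    | _, .zero => fun _ => 0
    | _, .one => fun _ => 1
    | _, .top => fun _ => ⊤
    | _, .bot => fun _ => ⊤ ⇨ 0
    | _, .neg => fun x => x 0 ⇨ 0
    | _, .mul => fun x => x 0 * x 1
    | _, .imp => fun x => x 0 ⇨ x 1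
    | _, .meet => fun x => x 0 ⊓ x 1
    | _, .join => fun x => x 0 ⊔ x 1
  RelMap := fun r => r.elim

/-- The class of bounded Girard algebras, as a class of algebras in the language of MALL. -/
def asClass : AAL.AlgebraClass.{u} MALL.lang :=
  fun (A : Type u) [s : MALL.lang.Structure A] => ∃ B : BoundedGirardAlgebra A, s = B.mallStructure

end BoundedGirardAlgebra

/-! ### Uniqueness of the equivalent quasivariety, for any deductive system. -/

namespace AAL

open FirstOrder.Language

variable {L : FirstOrder.Language.{0, 0}}

/-! Uniqueness holds for any system. In an equivalent semantics an equation φ ≈ ψ holds exactly when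
the translation of Δ(φ, ψ) does, so consequence between equations becomes derivability between sets
of congruence formulas. Two choices of congruence formulas are interderivable
(`proves_equivFormulas`), so two semantics have the same equational consequence
(`eqConsequence_of`), in particular the same quasi-identities; these determine a quasivariety.

For MALL, soundness is a computation in residuated lattices (`one_le_eval_of_derives`), and
completeness comes from the Lindenbaum algebra of Γ, in which 1 ≤ [p] iff Γ ⊢ p. Since 1 ≤ a iff a ∧
1 = 1, and 1 ≤ a → b iff a ≤ b, antisymmetry makes the stated defining equation and congruence
formulas work. The class is a variety because residuation can be replaced by identities
(`asClass_of_validEquations`). -/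

theorem Equation.holds_subst {α β : Type} (e : Equation L α) (σ : α → L.Term β) {A : Type u}
    [L.Structure A] (v : β → A) :
    (e.subst σ).Holds v ↔ e.Holds fun a => (σ a).realize v := by
  simp only [Equation.Holds, Equation.subst, Term.realize_subst]

theorem realize_vec_one {A : Type u} [L.Structure A] (v : ℕ → A) (φ : L.Term ℕ) :
    (fun i => Term.realize v ((![φ] : Fin 1 → L.Term ℕ) i)) = ![φ.realize v] := by
  funext i; fin_cases i; rfl

theorem realize_vec_two {A : Type u} [L.Structure A] (v : ℕ → A) (φ ψ : L.Term ℕ) :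
    (fun i => Term.realize v ((![φ, ψ] : Fin 2 → L.Term ℕ) i)) =
      ![φ.realize v, ψ.realize v] := by
  funext i; fin_cases i <;> rfl

namespace IsEquivalentAlgebraicSemantics

variable {S : DeductiveSystem L} {K : AlgebraClass.{u} L} {τ : Set (Equation L (Fin 1))}
  {Δ : Set (L.Term (Fin 2))}

/-- Two formulas have equal values under an assignment iff the equations of
`τ(Δ(φ, ψ))` hold under it. -/
theorem holds_iff (h : IsEquivalentAlgebraicSemantics S K τ Δ) {A : Type u} [L.Structure A]
    (hA : K A) (v : ℕ → A) (φ ψ : L.Term ℕ) :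
    φ.realize v = ψ.realize v ↔
      ∀ χ ∈ equivFormulas Δ φ ψ, ∀ e ∈ translate τ χ, e.Holds v := by
  constructor
  · intro hv χ hχ e he
    refine h.of_eq φ ψ e (Set.mem_biUnion hχ he) A hA v ?_
    rintro d rfl
    exact hv
  · intro hv
    refine h.to_eq φ ψ A hA v ?_
    intro d hd
    simp only [Set.mem_iUnion] at hd
    obtain ⟨χ, hχ, hd⟩ := hd
    exact hv χ hχ d hd

theorem proves_iff_holds (h : IsEquivalentAlgebraicSemantics S K τ Δ) (Γ : Set (L.Term ℕ))
    (φ : L.Term ℕ) :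
    S.Proves Γ φ ↔ ∀ (A : Type u) [L.Structure A], K A → ∀ v : ℕ → A,
      (∀ γ ∈ Γ, ∀ e ∈ translate τ γ, e.Holds v) → ∀ e ∈ translate τ φ, e.Holds v := by
  rw [h.proves_iff]
  constructor
  · intro H A _ hA v hv e he
    refine H e he A hA v fun d hd => ?_
    simp only [Set.mem_iUnion] at hd
    obtain ⟨χ, hχ, hd⟩ := hd
    exact hv χ hχ d hd
  · intro H e he A _ hA v hv
    exact H A hA v (fun γ hγ d hd => hv d (Set.mem_biUnion hγ hd)) e he

theorem proves_refl (h : IsEquivalentAlgebraicSemantics S K τ Δ) (Γ : Set (L.Term ℕ))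
    (φ : L.Term ℕ) {χ : L.Term ℕ} (hχ : χ ∈ equivFormulas Δ φ φ) : S.Proves Γ χ :=
  (h.proves_iff_holds Γ χ).2 fun _ _ hA v _ => (h.holds_iff hA v φ φ).1 rfl χ hχ

variable {K' : AlgebraClass.{u} L} {τ' : Set (Equation L (Fin 1))} {Δ' : Set (L.Term (Fin 2))}

/-- Any two sets of equivalence formulas are interderivable. -/
theorem proves_equivFormulas (h : IsEquivalentAlgebraicSemantics S K τ Δ)
    (h' : IsEquivalentAlgebraicSemantics S K' τ' Δ') (φ ψ : L.Term ℕ) {χ : L.Term ℕ}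
    (hχ : χ ∈ equivFormulas Δ φ ψ) : S.Proves (equivFormulas Δ' φ ψ) χ := by
  rw [h'.proves_iff_holds]
  intro A _ hA v hv
  have hφψ := (h'.holds_iff hA v φ ψ).2 hv
  obtain ⟨d, hd, rfl⟩ := hχ
  -- The instance d(φ, φ) is a theorem, so its τ'-equations hold under `v`. Since φ and ψ have equal
  -- values, d(φ, ψ) has the same value as d(φ, φ).
  have hrefl := (h'.proves_iff_holds ∅ _).1
    (h.proves_refl ∅ φ (Set.mem_image_of_mem _ hd)) A hA v (by simp)
  rintro _ ⟨e, he, rfl⟩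
  have key := hrefl _ (Set.mem_image_of_mem _ he)
  simp only [Equation.holds_subst, realize_vec_one, Term.realize_subst, realize_vec_two] at key ⊢
  rwa [← hφψ]

/-- Equivalent algebraic semantics of the same system have the same equational consequence. -/
theorem eqConsequence_of (h : IsEquivalentAlgebraicSemantics S K τ Δ)
    (h' : IsEquivalentAlgebraicSemantics S K' τ' Δ') {Θ : Set (Equation L ℕ)} {e : Equation L ℕ}
    (H : EqConsequence K Θ e) : EqConsequence K' Θ e := by
  intro A _ hA v hv
  refine (h'.holds_iff hA v e.lhs e.rhs).2 fun χ hχ => ?_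
  -- Over `K` each equation can be traded for its Δ-formulas, which turns the consequence into a
  -- statement about `S` alone.
  have hΔ : ∀ ξ ∈ equivFormulas Δ e.lhs e.rhs,
      S.Proves (⋃ d ∈ Θ, equivFormulas Δ d.lhs d.rhs) ξ := by
    intro ξ hξ
    rw [h.proves_iff_holds]
    intro B _ hB w hw
    refine (h.holds_iff hB w e.lhs e.rhs).1 (H B hB w fun d hd => ?_) ξ hξ
    exact (h.holds_iff hB w d.lhs d.rhs).2 fun γ hγ => hw γ (Set.mem_biUnion hd hγ)
  -- Both ends pass from Δ to Δ' by cut; the derivation can then be read in `K'`.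
  have hΔ' : S.Proves (⋃ d ∈ Θ, equivFormulas Δ' d.lhs d.rhs) χ := by
    refine S.cut (S.cut (h'.proves_equivFormulas h e.lhs e.rhs hχ) hΔ) fun γ hγ => ?_
    simp only [Set.mem_iUnion] at hγ
    obtain ⟨d, hd, hγ⟩ := hγ
    exact S.cut (h.proves_equivFormulas h' d.lhs d.rhs hγ) fun ξ hξ =>
      S.refl (Set.mem_biUnion hd hξ)
  refine (h'.proves_iff_holds _ χ).1 hΔ' A hA v fun γ hγ => ?_
  simp only [Set.mem_iUnion] at hγ
  obtain ⟨d, hd, hγ⟩ := hγ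
  exact (h'.holds_iff hA v d.lhs d.rhs).1 (hv d hd) γ hγ

/-- A quasivariety contains every equivalent algebraic semantics of a system of which it is one. -/
theorem subclass_of_isQuasivariety (h : IsEquivalentAlgebraicSemantics S K τ Δ)
    (h' : IsEquivalentAlgebraicSemantics S K' τ' Δ') (hK : IsQuasivariety K)
    (A : Type u) [L.Structure A] (hA : K' A) : K A := by
  obtain ⟨Q, hQ⟩ := hK
  refine (hQ A).2 fun q hq v hv => ?_
  exact h.eqConsequence_of h' (Θ := {e | e ∈ q.premises})
    (fun B _ hB w hw => (hQ B).1 hB q hq w hw) A hA v hv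

end IsEquivalentAlgebraicSemantics

theorem IsVariety.isQuasivariety {K : AlgebraClass.{u} L} (hK : IsVariety K) :
    IsQuasivariety K := by
  obtain ⟨E, hE⟩ := hK
  refine ⟨(fun e => ⟨[], e⟩) '' E, fun A _ => ?_⟩
  simp [hE]

end AAL

/-! ### Derived rules of MALL. -/

namespace MALL

open FirstOrder.Language

namespace Derives

variable {Γ : Set (Formula ℕ)} {p p' q q' r s : Formula ℕ}

theorem imp_self (p : Formula ℕ) : Derives Γ (p ⇨ p) := .ax (.hl1 p)

theorem trans (h₁ : Derives Γ (p ⇨ q)) (h₂ : Derives Γ (q ⇨ r)) : Derives Γ (p ⇨ r) :=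
  .mp h₂ (.mp h₁ (.ax (.hl2 p q r)))

theorem swap (h : Derives Γ (p ⇨ (q ⇨ r))) : Derives Γ (q ⇨ (p ⇨ r)) :=
  .mp h (.ax (.hl3 p q r))

/-- HL2 gives contravariance on the left; with its antecedents permuted it gives covariance on the
right. -/
theorem imp_mono (h₁ : Derives Γ (p' ⇨ p)) (h₂ : Derives Γ (q ⇨ q')) :
    Derives Γ ((p ⇨ q) ⇨ (p' ⇨ q')) :=
  trans (.mp h₁ (.ax (.hl2 p' p q))) (.mp h₂ (swap (.ax (.hl2 p' q q'))))

theorem curry_iff : Derives Γ ((p * q) ⇨ r) ↔ Derives Γ (p ⇨ (q ⇨ r)) :=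
  ⟨fun h => trans (.ax (.hl6 p q)) (imp_mono (imp_self q) h), fun h => .mp h (.ax (.hl7 p q r))⟩

theorem mul_mono (h₁ : Derives Γ (p ⇨ p')) (h₂ : Derives Γ (q ⇨ q')) :
    Derives Γ ((p * q) ⇨ (p' * q')) :=
  curry_iff.2 (trans h₁ (trans (.ax (.hl6 p' q')) (imp_mono h₂ (imp_self _))))

theorem mul_comm (p q : Formula ℕ) : Derives Γ ((p * q) ⇨ (q * p)) :=
  curry_iff.2 (swap (.ax (.hl6 q p)))

theorem mul_mul_imp_iff : Derives Γ (((p * q) * r) ⇨ s) ↔ Derives Γ (p ⇨ (q ⇨ (r ⇨ s))) :=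
  curry_iff.trans curry_iff

/-- With `mul_mul_imp_iff`, this shows that both bracketings imply the same formulas, which yields
associativity. Permuting `p` past the inner product brings `q * r` to the front, where currying
applies. -/
theorem mul_mul_imp_iff' : Derives Γ ((p * (q * r)) ⇨ s) ↔ Derives Γ (p ⇨ (q ⇨ (r ⇨ s))) :=
  ⟨fun h => swap (trans (curry_iff.1 (swap (curry_iff.1 h))) (.ax (.hl3 r p s))),
    fun h => curry_iff.2 (swap (curry_iff.2 (trans (swap h) (.ax (.hl3 p r s)))))⟩

theorem imp_one_imp (p : Formula ℕ) : Derives Γ (p ⇨ (1 ⇨ p)) := swap (.ax (.hl9 p))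

theorem one_imp_iff : Derives Γ (1 ⇨ p) ↔ Derives Γ p :=
  ⟨fun h => .mp (.ax .hl8) h, fun h => .mp h (imp_one_imp p)⟩

theorem mul_one_imp (p : Formula ℕ) : Derives Γ ((p * 1) ⇨ p) := curry_iff.2 (imp_one_imp p)

theorem imp_mul_one (p : Formula ℕ) : Derives Γ (p ⇨ (p * 1)) :=
  .mp (.ax .hl8) (swap (.ax (.hl6 p 1)))

theorem meet_mono (h₁ : Derives Γ (p ⇨ p')) (h₂ : Derives Γ (q ⇨ q')) :
    Derives Γ ((p ⊓ q) ⇨ (p' ⊓ q')) :=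
  .mp (.adj (trans (.ax (.hl12 p q)) h₁) (trans (.ax (.hl13 p q)) h₂)) (.ax (.hl14 _ _ _))

theorem join_mono (h₁ : Derives Γ (p ⇨ p')) (h₂ : Derives Γ (q ⇨ q')) :
    Derives Γ ((p ⊔ q) ⇨ (p' ⊔ q')) :=
  .mp (.adj (trans h₁ (.ax (.hl15 p' q'))) (trans h₂ (.ax (.hl16 p' q')))) (.ax (.hl17 _ _ _))

theorem neg_imp (p : Formula ℕ) : Derives Γ (pᶜ ⇨ (p ⇨ 0)) := swap (.ax (.hl10 p))

/-- The axiom ¬0 gives 1 → ¬0, hence 0 → ¬1 by contraposition. So p → 0 yields p → ¬1, which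
contraposes to 1 → ¬p, and the antecedent 1 can be dropped. -/
theorem imp_zero_imp_neg (p : Formula ℕ) : Derives Γ ((p ⇨ 0) ⇨ pᶜ) := by
  have h₀ : Derives Γ (0 ⇨ 1ᶜ) := .mp (one_imp_iff.2 (.ax .hl11)) (.ax (.hl5 1 0))
  have h₁ : Derives Γ ((p ⇨ 1ᶜ) ⇨ (1 ⇨ pᶜ)) := .ax (.hl5 p 1)
  exact trans (imp_mono (imp_self p) h₀) (trans h₁ (.mp (.ax .hl8) (swap (imp_self _))))

theorem imp_zero_imp_zero_imp (p : Formula ℕ) : Derives Γ (((p ⇨ 0) ⇨ 0) ⇨ p) :=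
  trans (imp_mono (neg_imp p) (imp_self 0)) (trans (imp_zero_imp_neg _) (.ax (.hl4 p)))

/-- Needed because ⊥ is primitive in the logic but defined as ¬⊤ in the algebras: everything implies
⊤, in particular ⊥ → 0, and double negation finishes. -/
theorem top_imp_zero_imp_bot : Derives Γ ((⊤ ⇨ 0) ⇨ ⊥) :=
  trans (imp_mono (.ax (.hl18 (⊥ ⇨ 0))) (imp_self 0)) (imp_zero_imp_zero_imp ⊥)

end Derives

/-! ### The Lindenbaum algebra. -/

/-- Interderivability of formulas over `Γ`. -/
def interderivable (Γ : Set (Formula ℕ)) : Setoid (ULift.{u} (Formula ℕ)) where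
  r p q := Derives Γ (p.down ⇨ q.down) ∧ Derives Γ (q.down ⇨ p.down)
  iseqv := ⟨fun _ => ⟨.imp_self _, .imp_self _⟩, fun h => ⟨h.2, h.1⟩,
    fun h k => ⟨h.1.trans k.1, k.2.trans h.2⟩⟩

/-- The Lindenbaum algebra of the theory generated by `Γ`. -/
def Lindenbaum (Γ : Set (Formula ℕ)) : Type u := Quotient (interderivable.{u} Γ)

namespace Lindenbaum

variable {Γ : Set (Formula ℕ)}

/-- The class of a formula. -/
def mk (Γ : Set (Formula ℕ)) (p : Formula ℕ) : Lindenbaum.{u} Γ := Quotient.mk _ ⟨p⟩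

theorem ind {P : Lindenbaum.{u} Γ → Prop} (h : ∀ p, P (mk Γ p)) (a : Lindenbaum.{u} Γ) : P a :=
  Quotient.ind (fun p => h p.down) a

theorem mk_eq_of {p q : Formula ℕ} (h₁ : Derives Γ (p ⇨ q)) (h₂ : Derives Γ (q ⇨ p)) :
    mk.{u} Γ p = mk Γ q :=
  Quotient.sound ⟨h₁, h₂⟩

instance : LE (Lindenbaum.{u} Γ) where
  le := Quotient.lift₂ (fun p q => Derives Γ (p.down ⇨ q.down)) fun _ _ _ _ h k => propext
    ⟨fun H => h.2.trans (H.trans k.1), fun H => h.1.trans (H.trans k.2)⟩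

/-- The order of the Lindenbaum algebra is derivability of the implication. -/
instance : PartialOrder (Lindenbaum.{u} Γ) where
  le_refl := ind fun p => .imp_self p
  le_trans := ind fun _ => ind fun _ => ind fun _ => Derives.trans
  le_antisymm := ind fun _ => ind fun _ => mk_eq_of

/-- Additive conjunction and disjunction are the lattice operations. -/
instance : Lattice (Lindenbaum.{u} Γ) where
  inf := Quotient.map₂ (fun p q => ⟨p.down ⊓ q.down⟩) fun _ _ h _ _ k =>
    ⟨.meet_mono h.1 k.1, .meet_mono h.2 k.2⟩
  sup := Quotient.map₂ (fun p q => ⟨p.down ⊔ q.down⟩) fun _ _ h _ _ k =>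
    ⟨.join_mono h.1 k.1, .join_mono h.2 k.2⟩
  inf_le_left := ind fun p => ind fun q => .ax (.hl12 p q)
  inf_le_right := ind fun p => ind fun q => .ax (.hl13 p q)
  le_inf := ind fun _ => ind fun _ => ind fun _ h k => .mp (.adj h k) (.ax (.hl14 _ _ _))
  le_sup_left := ind fun p => ind fun q => .ax (.hl15 p q)
  le_sup_right := ind fun p => ind fun q => .ax (.hl16 p q)
  sup_le := ind fun _ => ind fun _ => ind fun _ h k => .mp (.adj h k) (.ax (.hl17 _ _ _))

instance : Mul (Lindenbaum.{u} Γ) where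
  mul := Quotient.map₂ (fun p q => ⟨p.down * q.down⟩) fun _ _ h _ _ k =>
    ⟨.mul_mono h.1 k.1, .mul_mono h.2 k.2⟩

instance : One (Lindenbaum.{u} Γ) := ⟨mk Γ 1⟩

theorem mk_mul_one (a : Lindenbaum.{u} Γ) : a * 1 = a :=
  ind (P := fun a => a * 1 = a) (fun p => mk_eq_of (.mul_one_imp p) (.imp_mul_one p)) a

theorem mk_mul_comm (a b : Lindenbaum.{u} Γ) : a * b = b * a := by
  induction a using ind with | h p
  induction b using ind with | h q
  exact mk_eq_of (.mul_comm p q) (.mul_comm q p)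

/-- Multiplicative conjunction is the monoid operation. -/
instance : CommMonoid (Lindenbaum.{u} Γ) where
  mul_assoc := ind fun p => ind fun q => ind fun r =>
    mk_eq_of (Derives.mul_mul_imp_iff.2 (Derives.mul_mul_imp_iff'.1 (.imp_self _)))
      (Derives.mul_mul_imp_iff'.2 (Derives.mul_mul_imp_iff.1 (.imp_self _)))
  mul_one := mk_mul_one
  one_mul a := by rw [mk_mul_comm, mk_mul_one]
  mul_comm := mk_mul_comm

/-- The Lindenbaum algebra is a bounded Girard algebra. -/
instance : BoundedGirardAlgebra (Lindenbaum.{u} Γ) where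
  himp := Quotient.map₂ (fun p q => ⟨p.down ⇨ q.down⟩) fun _ _ h _ _ k =>
    ⟨.imp_mono h.2 k.1, .imp_mono h.1 k.2⟩
  residuation := ind fun _ => ind fun _ => ind fun _ =>
    ⟨fun h => (Derives.curry_iff.1 h).swap, fun h => Derives.curry_iff.2 h.swap⟩
  zero := mk Γ 0
  involutive := ind fun p => mk_eq_of (.imp_zero_imp_zero_imp p) (.swap (.imp_self _))
  top := mk Γ ⊤
  one_le_himp_top := ind fun p => Derives.one_imp_iff.2 (.ax (.hl18 p))

end Lindenbaum

end MALL

/-! ### Evaluation of formulas and soundness. -/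

namespace BoundedGirardAlgebra

open FirstOrder.Language MALL

section Eval

variable {A : Type u} [B : BoundedGirardAlgebra A]

/-- The value of a formula in a bounded Girard algebra. -/
def eval {α : Type} (v : α → A) (p : Formula α) : A :=
  @Term.realize lang A B.mallStructure α v p

variable {α : Type} (v : α → A) (p q : Formula α)

@[simp] theorem eval_zero : eval v (0 : Formula α) = 0 := rfl
@[simp] theorem eval_one : eval v (1 : Formula α) = 1 := rfl
@[simp] theorem eval_top : eval v (⊤ : Formula α) = ⊤ := rfl
@[simp] theorem eval_bot : eval v (⊥ : Formula α) = ⊤ ⇨ 0 := rfl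
@[simp] theorem eval_neg : eval v pᶜ = eval v p ⇨ 0 := rfl
@[simp] theorem eval_mul : eval v (p * q) = eval v p * eval v q := rfl
@[simp] theorem eval_imp : eval v (p ⇨ q) = eval v p ⇨ eval v q := rfl
@[simp] theorem eval_meet : eval v (p ⊓ q) = eval v p ⊓ eval v q := rfl
@[simp] theorem eval_join : eval v (p ⊔ q) = eval v p ⊔ eval v q := rfl

end Eval

section Order

variable {A : Type u} [BoundedGirardAlgebra A] {a b c : A}

theorem le_himp_iff_mul_le : b ≤ a ⇨ c ↔ a * b ≤ c :=
  (CommResiduatedLattice.residuation a b c).symm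

/-- By residuation and commutativity both sides say that `a * b` is below `c`. With `c = 0` this is
contraposition. -/
theorem le_himp_swap : a ≤ b ⇨ c ↔ b ≤ a ⇨ c := by
  rw [le_himp_iff_mul_le, le_himp_iff_mul_le, mul_comm]

theorem one_le_himp_iff : 1 ≤ a ⇨ b ↔ a ≤ b := by rw [le_himp_iff_mul_le, mul_one]

theorem mul_himp_le (a b : A) : a * (a ⇨ b) ≤ b := le_himp_iff_mul_le.1 le_rfl

theorem mul_le_mul_of_le_left (c : A) (h : a ≤ b) : c * a ≤ c * b :=
  le_himp_iff_mul_le.1 (h.trans (le_himp_iff_mul_le.2 le_rfl))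

theorem le_top_const (a : A) : a ≤ ⊤ := one_le_himp_iff.1 (one_le_himp_top a)

theorem himp_himp_le_swap (a b c : A) : a ⇨ (b ⇨ c) ≤ b ⇨ (a ⇨ c) := by
  rw [le_himp_iff_mul_le, le_himp_iff_mul_le, mul_left_comm]
  exact (mul_le_mul_of_le_left b (mul_himp_le _ _)).trans (mul_himp_le _ _)

theorem himp_le_himp_himp (a b c : A) : a ⇨ b ≤ (b ⇨ c) ⇨ (a ⇨ c) := by
  rw [le_himp_iff_mul_le, le_himp_iff_mul_le, mul_left_comm]
  refine (mul_le_mul_of_le_left _ (mul_himp_le a b)).trans ?_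
  rw [mul_comm]
  exact mul_himp_le b c

theorem one_le_eval_of_isAxiom {p : Formula ℕ} (h : IsAxiom p) (v : ℕ → A) : 1 ≤ eval v p := by
  cases h <;> simp only [eval_zero, eval_one, eval_top, eval_bot, eval_neg, eval_mul, eval_imp,
    eval_meet, eval_join, one_le_himp_iff, le_refl, inf_le_left, inf_le_right, le_sup_left,
    le_sup_right, le_top_const]
  case hl2 p q r => exact himp_le_himp_himp _ _ _
  case hl3 p q r => exact himp_himp_le_swap _ _ _
  case hl4 p => exact (GirardAlgebra.involutive _).le
  -- As negation is implication of 0, contraposition is an instance of exchange.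
  case hl5 p q => exact himp_himp_le_swap _ _ _
  case hl6 p q => exact le_himp_swap.1 (le_himp_iff_mul_le.2 le_rfl)
  case hl7 p q r =>
    rw [le_himp_iff_mul_le, mul_comm (eval v p), mul_assoc]
    exact (mul_le_mul_of_le_left _ (mul_himp_le _ _)).trans (mul_himp_le _ _)
  case hl10 p => exact (GirardAlgebra.involutive _).ge
  case hl14 p q r =>
    rw [le_himp_iff_mul_le]
    exact le_inf ((mul_le_mul_of_le_left _ inf_le_left).trans (mul_himp_le _ _))
      ((mul_le_mul_of_le_left _ inf_le_right).trans (mul_himp_le _ _))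
  case hl17 p q r =>
    rw [le_himp_swap]
    exact sup_le (le_himp_swap.1 inf_le_left) (le_himp_swap.1 inf_le_right)
  case hl19 p =>
    -- Writing the value of `p` as a double negation and contraposing reduces the claim to ¬p ≤ ⊤.
    rw [← GirardAlgebra.involutive (eval v p), le_himp_swap, GirardAlgebra.involutive]
    exact le_top_const _

theorem one_le_eval_of_derives {Γ : Set (Formula ℕ)} {p : Formula ℕ} (h : Derives Γ p)
    (v : ℕ → A) (hv : ∀ γ ∈ Γ, 1 ≤ eval v γ) : 1 ≤ eval v p := by
  induction h with
  | hyp h => exact hv _ h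
  | ax h => exact one_le_eval_of_isAxiom h v
  | mp _ _ ih₁ ih₂ => exact ih₁.trans (one_le_himp_iff.1 ih₂)
  | adj _ _ ih₁ ih₂ => exact le_inf ih₁ ih₂

end Order

end BoundedGirardAlgebra

/-! ### Completeness and the equivalent algebraic semantics. -/

namespace MALL

open FirstOrder.Language BoundedGirardAlgebra

/-- The truth lemma for the canonical assignment. Only ¬ and ⊥ need an argument, since the algebra
interprets them through → and 0; the other operations are induced by their connectives. -/
theorem Lindenbaum.eval_mk (Γ : Set (Formula ℕ)) (p : Formula ℕ) :
    eval (fun n => Lindenbaum.mk.{u} Γ (Formula.var n)) p = Lindenbaum.mk Γ p := by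
  induction p with
  | var n => rfl
  | @func n f ts ih =>
    change Connective n at f
    have h₂ (ts : Fin 2 → Formula ℕ) : ts = ![ts 0, ts 1] := by funext i; fin_cases i <;> rfl
    have h₁ (ts : Fin 1 → Formula ℕ) : ts = ![ts 0] := by funext i; fin_cases i; rfl
    have h₀ (ts : Fin 0 → Formula ℕ) : ts = ![] := by funext i; exact i.elim0
    cases f
    case zero => rw [h₀ ts]; rfl
    case one => rw [h₀ ts]; rfl
    case top => rw [h₀ ts]; rfl
    case bot =>
      rw [h₀ ts]
      exact Lindenbaum.mk_eq_of .top_imp_zero_imp_bot (.ax (.hl19 _))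
    case neg =>
      rw [h₁ ts]
      refine (congrArg (· ⇨ (0 : Lindenbaum.{u} Γ)) (ih 0)).trans ?_
      exact Lindenbaum.mk_eq_of (.imp_zero_imp_neg _) (.neg_imp _)
    case mul => rw [h₂ ts]; exact congrArg₂ (· * ·) (ih 0) (ih 1)
    case imp => rw [h₂ ts]; exact congrArg₂ (· ⇨ ·) (ih 0) (ih 1)
    case meet => rw [h₂ ts]; exact congrArg₂ (· ⊓ ·) (ih 0) (ih 1)
    case join => rw [h₂ ts]; exact congrArg₂ (· ⊔ ·) (ih 0) (ih 1)

theorem Lindenbaum.one_le_mk {Γ : Set (Formula ℕ)} {p : Formula ℕ} :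
    1 ≤ Lindenbaum.mk.{u} Γ p ↔ Derives Γ p :=
  Derives.one_imp_iff

/-- Soundness and completeness of MALL for bounded Girard algebras. -/
theorem derives_iff {Γ : Set (Formula ℕ)} {p : Formula ℕ} :
    Derives Γ p ↔ ∀ (A : Type u) [BoundedGirardAlgebra A] (v : ℕ → A),
      (∀ γ ∈ Γ, 1 ≤ eval v γ) → 1 ≤ eval v p := by
  refine ⟨fun h A _ v => one_le_eval_of_derives h v, fun h => ?_⟩
  -- The countermodel is built from `Γ` itself; the lift of formulas to universe `u` makes it an
  -- admissible instance of `h`.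
  have := h (Lindenbaum.{u} Γ) (fun n => Lindenbaum.mk Γ (Formula.var n))
  simp only [Lindenbaum.eval_mk, Lindenbaum.one_le_mk] at this
  exact this fun _ => .hyp

theorem translate_definingEquations (p : Formula ℕ) :
    AAL.translate definingEquations p = {⟨p ⊓ 1, 1⟩} := by
  simp only [AAL.translate, definingEquations, Set.image_singleton, AAL.Equation.subst,
    Formula.subst_meet, Formula.subst_one]
  rfl

theorem equivFormulas_congruenceFormulas (p q : Formula ℕ) :
    AAL.equivFormulas congruenceFormulas p q = {p ⇨ q, q ⇨ p} := by
  simp only [AAL.equivFormulas, congruenceFormulas, Set.image_pair, Formula.subst_imp]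
  rfl

/-- Consequence over the bounded Girard algebras. -/
theorem eqConsequence_asClass_iff {Θ : Set (AAL.Equation lang ℕ)} {e : AAL.Equation lang ℕ} :
    AAL.EqConsequence BoundedGirardAlgebra.asClass.{u} Θ e ↔
      ∀ (A : Type u) [BoundedGirardAlgebra A] (v : ℕ → A),
        (∀ d ∈ Θ, eval v d.lhs = eval v d.rhs) → eval v e.lhs = eval v e.rhs := by
  constructor
  · intro h A B v hv
    exact @h A B.mallStructure ⟨B, rfl⟩ v hv
  · rintro h A s ⟨B, rfl⟩ v hv
    exact h A v hv

/-- Bounded Girard algebras are an equivalent algebraic semantics of MALL. -/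
theorem isEquivalentAlgebraicSemantics_asClass :
    AAL.IsEquivalentAlgebraicSemantics system BoundedGirardAlgebra.asClass.{u}
      definingEquations congruenceFormulas where
  finite_defining := Set.finite_singleton _
  finite_equiv := (Set.finite_singleton _).insert _
  proves_iff Γ p := by
    refine derives_iff.{u}.trans ?_
    simp only [translate_definingEquations, eqConsequence_asClass_iff, Set.mem_iUnion,
      Set.mem_singleton_iff, forall_eq, forall_exists_index, eval_meet, eval_one, inf_eq_right]
    refine forall₃_congr fun A _ v => imp_congr_left ⟨?_, fun h γ hγ => ?_⟩
    · rintro h _ γ hγ rfl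
      exact inf_eq_right.2 (h γ hγ)
    · exact inf_eq_right.1 (h _ γ hγ rfl)
  of_eq p q := by
    simp +contextual [equivFormulas_congruenceFormulas, translate_definingEquations,
      eqConsequence_asClass_iff, one_le_himp_iff]
  to_eq p q := by
    simp +contextual [equivFormulas_congruenceFormulas, translate_definingEquations,
      eqConsequence_asClass_iff, one_le_himp_iff, le_antisymm_iff]

end MALL

/-! ### Bounded Girard algebras form a variety. -/

namespace MALL

open FirstOrder.Language BoundedGirardAlgebra

section Structure

variable {A : Type u} [lang.Structure A] {α : Type} (v : α → A) (p q : Formula α)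

/-- The value of a constant in an algebra. -/
def nullary (A : Type u) [lang.Structure A] (f : Connective 0) : A :=
  Structure.funMap (L := lang) (n := 0) f ![]

/-- The unary operation of an algebra that interprets a connective. -/
def unary (f : Connective 1) (a : A) : A := Structure.funMap (L := lang) (n := 1) f ![a]

/-- The binary operation of an algebra that interprets a connective. -/
def binary (f : Connective 2) (a b : A) : A := Structure.funMap (L := lang) (n := 2) f ![a, b]

theorem realize_var (a : α) : Term.realize v (Formula.var a) = v a := rfl

theorem realize_zero : Term.realize v (0 : Formula α) = nullary A .zero :=
  congrArg (Structure.funMap (L := lang) (n := 0) _) (funext fun i => i.elim0)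

theorem realize_one : Term.realize v (1 : Formula α) = nullary A .one :=
  congrArg (Structure.funMap (L := lang) (n := 0) _) (funext fun i => i.elim0)

theorem realize_top : Term.realize v (⊤ : Formula α) = nullary A .top :=
  congrArg (Structure.funMap (L := lang) (n := 0) _) (funext fun i => i.elim0)

theorem realize_bot : Term.realize v (⊥ : Formula α) = nullary A .bot :=
  congrArg (Structure.funMap (L := lang) (n := 0) _) (funext fun i => i.elim0)

theorem realize_neg : Term.realize v pᶜ = unary .neg (Term.realize v p) :=
  congrArg (Structure.funMap (L := lang) (n := 1) _) (by funext i; fin_cases i; rfl)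

theorem realize_mul :
    Term.realize v (p * q) = binary .mul (Term.realize v p) (Term.realize v q) :=
  congrArg (Structure.funMap (L := lang) (n := 2) _) (by funext i; fin_cases i <;> rfl)

theorem realize_imp :
    Term.realize v (p ⇨ q) = binary .imp (Term.realize v p) (Term.realize v q) :=
  congrArg (Structure.funMap (L := lang) (n := 2) _) (by funext i; fin_cases i <;> rfl)

theorem realize_meet :
    Term.realize v (p ⊓ q) = binary .meet (Term.realize v p) (Term.realize v q) :=
  congrArg (Structure.funMap (L := lang) (n := 2) _) (by funext i; fin_cases i <;> rfl)

theorem realize_join :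
    Term.realize v (p ⊔ q) = binary .join (Term.realize v p) (Term.realize v q) :=
  congrArg (Structure.funMap (L := lang) (n := 2) _) (by funext i; fin_cases i <;> rfl)

end Structure

/-- The equations that are true in all bounded Girard algebras. -/
def validEquations : Set (AAL.Equation lang ℕ) :=
  {e | AAL.EqConsequence BoundedGirardAlgebra.asClass.{u} ∅ e}

/-- The assignment of three values to the first three variables. -/
def assign {A : Type u} (a b c : A) : ℕ → A
  | 0 => a
  | 1 => b
  | _ => c

/-- Algebras that satisfy the valid equations are bounded Girard algebras. -/
theorem asClass_of_validEquations (A : Type u) [S : lang.Structure A]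
    (hA : ∀ e ∈ validEquations.{u}, ∀ v : ℕ → A, e.Holds v) :
    BoundedGirardAlgebra.asClass A := by
  -- Any identity checked in all bounded Girard algebras may be used in `A`, at three chosen
  -- elements; laws with fewer variables later receive dummy arguments.
  have law (s t : Formula ℕ)
      (h : ∀ (B : Type u) [BoundedGirardAlgebra B] (v : ℕ → B), eval v s = eval v t)
      (a b c : A) : Term.realize (assign a b c) s = Term.realize (assign a b c) t :=
    hA ⟨s, t⟩ (eqConsequence_asClass_iff.2 fun B _ v _ => h B v) _
  let x : Formula ℕ := Formula.var 0
  let y : Formula ℕ := Formula.var 1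
  let z : Formula ℕ := Formula.var 2
  have sup_comm_law := law (x ⊔ y) (y ⊔ x) fun _ _ _ => sup_comm _ _
  have sup_assoc_law := law ((x ⊔ y) ⊔ z) (x ⊔ (y ⊔ z)) fun _ _ _ => sup_assoc _ _ _
  have inf_comm_law := law (x ⊓ y) (y ⊓ x) fun _ _ _ => inf_comm _ _
  have inf_assoc_law := law ((x ⊓ y) ⊓ z) (x ⊓ (y ⊓ z)) fun _ _ _ => inf_assoc _ _ _
  have sup_inf_law := law (x ⊔ (x ⊓ y)) x fun _ _ _ => sup_inf_self
  have inf_sup_law := law (x ⊓ (x ⊔ y)) x fun _ _ _ => inf_sup_self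
  have mul_assoc_law := law ((x * y) * z) (x * (y * z)) fun _ _ _ => mul_assoc _ _ _
  have mul_comm_law := law (x * y) (y * x) fun _ _ _ => mul_comm _ _
  have mul_one_law := law (x * 1) x fun _ _ _ => mul_one _
  -- The two directions of residuation as identities: y ≤ x → (xy ∨ z) and x((x → z) ∧ y) ≤ z. The
  -- extra join and meet collapse to z and y exactly under the respective hypotheses xy ≤ z and y ≤
  -- x → z.
  have le_himp_law := law (y ⊔ (x ⇨ ((x * y) ⊔ z))) (x ⇨ ((x * y) ⊔ z)) fun _ _ _ =>
    sup_of_le_right (le_himp_iff_mul_le.2 le_sup_left)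
  have mul_le_law := law ((x * ((x ⇨ z) ⊓ y)) ⊔ z) z fun _ _ _ =>
    sup_of_le_right (le_himp_iff_mul_le.1 inf_le_left)
  have involutive_law := law ((x ⇨ 0) ⇨ 0) x fun _ _ _ => GirardAlgebra.involutive _
  have one_le_law := law (1 ⊔ (x ⇨ ⊤)) (x ⇨ ⊤) fun _ _ _ => sup_of_le_right (one_le_himp_top _)
  -- An arbitrary structure interprets ¬ and ⊥ freely; this law and the next force the
  -- interpretation that `mallStructure` prescribes.
  have neg_law := law (xᶜ) (x ⇨ 0) fun _ _ _ => rfl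
  have bot_law := law (⊥ : Formula ℕ) (⊤ ⇨ 0) fun _ _ _ => rfl
  simp only [x, y, z, realize_var, realize_zero, realize_one, realize_top, realize_bot, realize_neg,
    realize_mul, realize_imp, realize_meet, realize_join, assign] at *
  let : Max A := ⟨binary .join⟩
  let : Min A := ⟨binary .meet⟩
  let lattice : Lattice A := Lattice.mk' (fun a b => sup_comm_law a b b) sup_assoc_law
    (fun a b => inf_comm_law a b b) inf_assoc_law (fun a b => sup_inf_law a b b)
    (fun a b => inf_sup_law a b b)
  let monoid : CommMonoid A :=
    { mul := binary .mul
      one := nullary A .one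
      mul_assoc := mul_assoc_law
      mul_comm := fun a b => mul_comm_law a b b
      mul_one := fun a => mul_one_law a a a
      one_mul := fun a => (mul_comm_law _ a a).trans (mul_one_law a a a) }
  let B : BoundedGirardAlgebra A :=
    { lattice, monoid with
      himp := binary .imp
      zero := nullary A .zero
      top := nullary A .top
      residuation := fun a b c => by
        constructor
        · intro h
          have hc : binary .join (binary .mul a b) c = c := sup_eq_right.2 h
          have key := le_himp_law a b c
          rw [hc] at key
          exact sup_eq_right.1 key
        · intro h
          have hb : binary .meet (binary .imp a c) b = b := inf_eq_right.2 h
          have key := mul_le_law a b c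
          rw [hb] at key
          exact sup_eq_right.1 key
      involutive := fun a => involutive_law a a a
      one_le_himp_top := fun a => sup_eq_right.1 (one_le_law a a a) }
  refine ⟨B, Structure.ext ?_ ?_⟩
  · funext n f ts
    change Connective n at f
    have h₂ (ts : Fin 2 → A) : ts = ![ts 0, ts 1] := by funext i; fin_cases i <;> rfl
    have h₁ (ts : Fin 1 → A) : ts = ![ts 0] := by funext i; fin_cases i; rfl
    have h₀ (ts : Fin 0 → A) : ts = ![] := by funext i; exact i.elim0
    cases f
    case zero => rw [h₀ ts]; rfl
    case one => rw [h₀ ts]; rfl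
    case top => rw [h₀ ts]; rfl
    case bot => rw [h₀ ts]; exact bot_law (nullary A .zero) (nullary A .zero) (nullary A .zero)
    case neg => rw [h₁ ts]; exact neg_law (ts 0) (ts 0) (ts 0)
    all_goals rw [h₂ ts]; rfl
  · funext n r
    exact r.elim

/-- The bounded Girard algebras form a variety. -/
theorem isVariety_asClass : AAL.IsVariety BoundedGirardAlgebra.asClass.{u} :=
  ⟨validEquations.{u}, fun A _ =>
    ⟨fun h _ he v => he A h v fun _ hd => hd.elim, asClass_of_validEquations A⟩⟩

end MALL

/-- MALL is algebraizable; the bounded Girard algebras form a variety, which is an equivalent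
algebraic semantics of MALL with defining equation `p ∧ 1 ≈ 1` and congruence formulas `p → q`,
`q → p`, and it is the only quasivariety that is an equivalent algebraic semantics of MALL (with
respect to any finite sets of defining equations and equivalence formulas). -/
theorem mainTheorem2 :
    AAL.Algebraizable.{u} MALL.system ∧
    AAL.IsVariety BoundedGirardAlgebra.asClass.{u} ∧
    AAL.IsEquivalentAlgebraicSemantics MALL.system BoundedGirardAlgebra.asClass.{u}
      MALL.definingEquations MALL.congruenceFormulas ∧
    ∀ K : AAL.AlgebraClass.{u} MALL.lang, AAL.IsQuasivariety K →
      (∃ (τ : Set (AAL.Equation MALL.lang (Fin 1))) (Δ : Set (MALL.Formula (Fin 2))),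
        AAL.IsEquivalentAlgebraicSemantics MALL.system K τ Δ) →
      ∀ (A : Type u) [MALL.lang.Structure A], K A ↔ BoundedGirardAlgebra.asClass A :=
  ⟨⟨_, _, _, MALL.isEquivalentAlgebraicSemantics_asClass⟩, MALL.isVariety_asClass,
    MALL.isEquivalentAlgebraicSemantics_asClass, fun _ hK ⟨_, _, h⟩ A _ =>
      -- Each inclusion uses only that the larger class is a quasivariety, so the roles are
      -- exchanged for the converse.
      ⟨MALL.isEquivalentAlgebraicSemantics_asClass.subclass_of_isQuasivariety h
          MALL.isVariety_asClass.isQuasivariety A,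
        h.subclass_of_isQuasivariety MALL.isEquivalentAlgebraicSemantics_asClass hK A⟩⟩
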